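/- Let $n\ge 0$, let $A_1,A_2$ be $\mathbb R$-linearly independent Hermitian $n\times n$ matrices with $\ker A_1\cap\ker A_2=\{0\}$, and let $Q\subset\mathbb C^{n}\times\mathbb C^2$ be the (nondegenerate, codimension $2$) quadric $\{(z,w): \operatorname{Im} w_l={}^t\bar z A_l z,\ l=1,2\}$. Give each $z_j$ weight $\tfrac12$ and each $w_l$ weight $1$. For $\mu\in\mathbb Q$ let $G_\mu$ be the set of holomorphic vector fields $Y=\sum_j F_j\,\partial/\partial z_j+\sum_l H_l\,\partial/\partial w_l$ such that $F_j$ and $H_l$ are weighted homogeneous polynomials in $(z,w)$ (possibly zero) of degree $\mu+\tfrac12$ and $\mu+1$ respectively, and $\operatorname{Re}Y$ is tangent to $Q$ near $0$ (that is, $Y\in \mathrm{aut}(Q,0)$). Let $G_\mu^R\subset G_\mu$ be the subset of rigid fields, i.e. those whose coefficients depend only on $z$. Write $W_l=\partial/\partial w_l$ and $\mathcal D^{(k)}_l(Y)=[\dots[[Y,W_l],W_l],\dots,W_l]$ ($k$ brackets). For $X\in G_\mu^R$ and $k=(k_1,k_2)\in\mathbb Z_{\ge0}^2$ with $|k|=k_1+k_2$,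 a field $Y\in G_{\mu+|k|}$ is called a $|k|$-integration of $X$ if $\mathcal D^{(k_1)}_1(\mathcal D^{(k_2)}_2(Y))=X$, where $X=0$ is allowed only if $Y=0$. For $m\ge 0$ let $\mathcal D^{-m}(G_\mu^R)$ be the set of all $m$-integrations of elements of $G_\mu^R$ (over all $k$ with $|k|=m$). Then: 1. $\mathcal D^{-1}(G_0^R)\setminus\bigl(\mathcal D^{-1}(G_0^R)\cap\mathcal D^{-2}(G_{-1}^R)\bigr)\subseteq\{0\}$; that is, every nonzero $1$-integration of an element of $G_0^R$ is also a $2$-integration of an element of $G_{-1}^R$. 2. $\mathcal D^{-2}(G_{-1/2}^R)=\{0\}$. 3. $\mathcal D^{-1}(G_{-1}^R)$ contains a nonzero vector field, and $\mathcal D^{-3}(G_{-1}^R)=\{0\}$. -/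

import Mathlib

open scoped Topology Matrix

namespace QuadricAut

/-- The ambient space `ℂⁿ × ℂᵈ` with coordinates `(z, w)`. -/
abbrev Ambient (n d : ℕ) : Type := (Fin n → ℂ) × (Fin d → ℂ)

/-- Polynomials in the coordinates `(z, w)`: `Sum.inl j` is the variable `z_j` and
`Sum.inr l` is the variable `w_l`. -/
abbrev Poly (n d : ℕ) : Type := MvPolynomial (Fin n ⊕ Fin d) ℂ

/-- Holomorphic polynomial vector fields `∑ F_j ∂/∂z_j + ∑ G_l ∂/∂w_l` on `ℂⁿ × ℂᵈ`, as derivations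
of the polynomial ring. The coefficients are the values on the variables, and the Lie bracket is
Mathlib's commutator bracket `⁅Y, Z⁆ = Y ∘ Z - Z ∘ Y` of derivations. -/
abbrev PolyField (n d : ℕ) : Type := Derivation ℂ (Poly n d) (Poly n d)

variable {n d : ℕ}

/-- The Hermitian form `ᵗz̄ A z` (which is real when `A` is Hermitian). -/
noncomputable def hermForm (A : Matrix (Fin n) (Fin n) ℂ) (z : Fin n → ℂ) : ℝ :=
  (star z ⬝ᵥ (A *ᵥ z)).re

/-- The defining function `Im w_l - ᵗz̄ A_l z`. -/
noncomputable def defFun (A : Fin d → Matrix (Fin n) (Fin n) ℂ) (l : Fin d)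
    (p : Ambient n d) : ℝ :=
  (p.2 l).im - hermForm (A l) p.1

/-- The quadric `Im w_l = ᵗz̄ A_l z`, `l = 1, …, d`. -/
def quadric (A : Fin d → Matrix (Fin n) (Fin n) ℂ) : Set (Ambient n d) :=
  {p | ∀ l, defFun A l p = 0}

/-- The quadric is given by linearly independent Hermitian matrices whose kernels have trivial
intersection. -/
structure Nondegenerate (A : Fin d → Matrix (Fin n) (Fin n) ℂ) : Prop where
  isHermitian : ∀ l, (A l).IsHermitian
  linearIndependent : LinearIndependent ℝ A
  ker_inter : ∀ z : Fin n → ℂ, (∀ l, A l *ᵥ z = 0) → z = 0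

/-- `aut(Q, 0)`: vector fields holomorphic near `0` whose real part is tangent to the quadric near
`0`. (The real vector field `2 Re Z` has at `p` the value `Z p`, seen as a real tangent vector of
`ℂⁿ × ℂᵈ`.) -/
def aut (A : Fin d → Matrix (Fin n) (Fin n) ℂ) : Set (Ambient n d → Ambient n d) :=
  {Z | AnalyticAt ℂ Z 0 ∧
    ∀ᶠ p in 𝓝[quadric A] 0, ∀ l, fderiv ℝ (defFun A l) p (Z p) = 0}

/-- The map `ℂⁿ × ℂᵈ → ℂⁿ × ℂᵈ` given by the coefficients of a polynomial vector field. -/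
noncomputable def toMap (Y : PolyField n d) (p : Ambient n d) : Ambient n d :=
  (fun j => MvPolynomial.eval (Sum.elim p.1 p.2) (Y (MvPolynomial.X (Sum.inl j))),
   fun l => MvPolynomial.eval (Sum.elim p.1 p.2) (Y (MvPolynomial.X (Sum.inr l))))

/-- The variables `z_j` have weight `1/2`, the variables `w_l` have weight `1`. -/
def wt (n d : ℕ) : Fin n ⊕ Fin d → ℚ := Sum.elim (fun _ => 1 / 2) (fun _ => 1)

/-- A polynomial vector field is weighted homogeneous of weight `μ` if its `∂/∂z_j`-coefficients
are weighted homogeneous of degree `μ + 1/2` and its `∂/∂w_l`-coefficients of degree `μ + 1`. -/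
def HasWeight (μ : ℚ) (Y : PolyField n d) : Prop :=
  (∀ j, MvPolynomial.IsWeightedHomogeneous (wt n d) (Y (MvPolynomial.X (Sum.inl j))) (μ + 1 / 2)) ∧
  (∀ l, MvPolynomial.IsWeightedHomogeneous (wt n d) (Y (MvPolynomial.X (Sum.inr l))) (μ + 1))

/-- The graded piece `G_μ` of `aut(Q, 0)`. -/
def G (A : Fin d → Matrix (Fin n) (Fin n) ℂ) (μ : ℚ) : Set (PolyField n d) :=
  {Y | HasWeight μ Y ∧ toMap Y ∈ aut A}

/-- A vector field is rigid if its coefficients do not involve any of the variables `w_l`. -/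
def IsRigid (Y : PolyField n d) : Prop :=
  ∀ c l, Sum.inr l ∉ (Y (MvPolynomial.X c)).vars

/-- `G_μ^R`: the rigid vector fields in `G_μ`. -/
def GR (A : Fin d → Matrix (Fin n) (Fin n) ℂ) (μ : ℚ) : Set (PolyField n d) :=
  {Y | Y ∈ G A μ ∧ IsRigid Y}

/-- The vector field `W_l = ∂/∂w_l`. -/
noncomputable def W (l : Fin d) : PolyField n d := MvPolynomial.pderiv (Sum.inr l)

/-- The string of `k` brackets `[…[[Y, W_l], W_l], …, W_l]`. -/
noncomputable def bracketW (l : Fin d) (k : ℕ) (Y : PolyField n d) : PolyField n d :=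
  (fun Z => ⁅Z, W l⁆)^[k] Y

/-- `D^{(k_1)}(⋯ (D^{(k_d)}(Y)) ⋯)`. -/
noncomputable def multiBracket (k : Fin d → ℕ) (Y : PolyField n d) : PolyField n d :=
  (List.finRange d).foldr (fun l Z => bracketW l (k l) Z) Y

/-- `Y ∈ G_{μ+|k|}` is a `|k|`-integration, along the multi-index `k`, of `X ∈ G_μ^R`. The last
clause expresses that a nonzero field is not regarded as an integration of `0`. -/
def IsIntegration (A : Fin d → Matrix (Fin n) (Fin n) ℂ) (μ : ℚ) (k : Fin d → ℕ)
    (X Y : PolyField n d) : Prop :=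
  X ∈ GR A μ ∧ Y ∈ G A (μ + ((∑ l, k l : ℕ) : ℚ)) ∧ multiBracket k Y = X ∧ (X = 0 → Y = 0)

/-- `D^{-m}(G_μ^R)`: all `m`-integrations of elements of `G_μ^R`, along all multi-indices `k` with
`|k| = m`. -/
def integrations (A : Fin d → Matrix (Fin n) (Fin n) ℂ) (m : ℕ) (μ : ℚ) : Set (PolyField n d) :=
  {Y | ∃ (k : Fin d → ℕ) (X : PolyField n d), ∑ l, k l = m ∧ IsIntegration A μ k X Y}

end QuadricAut

/-!
The dilations `(z, w) ↦ (t z, t² w)` turn tangency near `0` into tangency along the whole quadric,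
and the rotations `(t z, w)`, `|t| = 1`, split it into equations between the parts of fixed degree
in `z`. At the points `(z, (s + i) h(z))`, where `h(z) = (ᵗz̄ A_l z)_l`, these become polynomial
identities in the real parameter `s`. For a field of weight `2` they make the `∂/∂w`-part at `z = 0`
vanish at `w = h(z)`, for a field of weight `3/2` the `∂/∂z`-part. Polarizing `z̄` to an independent
variable `ζ`, the map `z ↦ (ᵗζ A_l z)_l` is onto for generic `ζ`, so these parts vanish
identically, and with them all `3`-integrations in degree `-1` and `2`-integrations in degree
`-1/2`.

Let now `Y` have weight `1` and suppose that all its second brackets with the `W_l` vanish. The part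
of its `∂/∂z`-coefficients linear in `z` and `w` is `∑ w_k B_k z`, tangency says that each `A_l B_k`
is skew-Hermitian and that `∑_k (ᵗz̄ A_k z) (ᵗz̄ A_l B_k z) = 0`, and in codimension two this forces
`B_0 = B_1 = 0`. A rigid bracket `[Y, W_l]` then has no `∂/∂z`-part, and so it is zero.
-/

namespace QuadricAut

open MvPolynomial

section Polynomials

variable {σ R : Type*} [CommSemiring R]

/-- The restriction `t ↦ f (x + t y)` of a polynomial to a line, as a polynomial in `t`. -/
noncomputable def restrictLine (f : MvPolynomial σ R) (x y : σ → R) : Polynomial R :=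
  aeval (fun i => Polynomial.C (x i) + Polynomial.C (y i) * Polynomial.X) f

lemma eval_restrictLine (f : MvPolynomial σ R) (x y : σ → R) (t : R) :
    (restrictLine f x y).eval t = eval (x + t • y) f := by
  rw [← Polynomial.coe_aeval_eq_eval, restrictLine, comp_aeval_apply]
  simp [aeval_eq_eval, Pi.add_def, mul_comm t]

lemma restrictLine_coeff_zero (f : MvPolynomial σ R) (x y : σ → R) :
    (restrictLine f x y).coeff 0 = eval x f := by
  simpa [Polynomial.coeff_zero_eq_eval_zero] using eval_restrictLine f x y 0

lemma restrictLine_coeff_one [Fintype σ] (f : MvPolynomial σ R) (x y : σ → R) :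
    (restrictLine f x y).coeff 1 = ∑ i, y i * eval x (pderiv i f) := by
  induction f using MvPolynomial.induction_on with
  | C a => simp [restrictLine]
  | add p q hp hq => simp_all [restrictLine, mul_add, Finset.sum_add_distrib]
  | mul_X p i hp =>
    have hmul : restrictLine (p * X i) x y = restrictLine p x y * Polynomial.C (x i)
        + restrictLine p x y * Polynomial.C (y i) * Polynomial.X := by
      simp [restrictLine, mul_add, mul_assoc]
    classical
    simp only [hmul, Polynomial.coeff_add, Polynomial.coeff_mul_C, hp, Finset.sum_mul,
      Polynomial.coeff_mul_X _ 0, Polynomial.mul_coeff_zero, restrictLine_coeff_zero,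
      Polynomial.coeff_C_zero, Derivation.leibniz, pderiv_X, Pi.single_apply, smul_eq_mul, mul_ite,
      mul_one, mul_zero, map_add, apply_ite (eval x), map_zero, map_mul, eval_X, mul_add,
      Finset.sum_add_distrib, Finset.sum_ite_eq, Finset.mem_univ, ↓reduceIte]
    simp only [add_comm, mul_assoc, mul_comm (x i), mul_comm (y i) (eval x p)]

lemma hasDerivAt_eval_add_smul [Fintype σ] (f : MvPolynomial σ ℂ) (x y : σ → ℂ) :
    HasDerivAt (fun t : ℂ => eval (x + t • y) f) (∑ i, y i * eval x (pderiv i f)) 0 := by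
  simp only [← eval_restrictLine, ← restrictLine_coeff_one]
  simpa [← Polynomial.coeff_zero_eq_eval_zero, Polynomial.coeff_derivative]
    using (restrictLine f x y).hasDerivAt 0

lemma pderiv_comm {R : Type*} [CommRing R] (i j : σ) (f : MvPolynomial σ R) :
    pderiv i (pderiv j f) = pderiv j (pderiv i f) := by
  classical
  have h : ⁅pderiv (R := R) i, pderiv (R := R) j⁆ = 0 :=
    derivation_ext fun k => by simp [Derivation.commutator_apply, pderiv_X, Pi.single_apply,
      apply_ite]
  rw [← sub_eq_zero, ← Derivation.commutator_apply, h, Derivation.zero_apply]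

lemma sum_weight_smul_X_mul_pderiv [Fintype σ] {S : Type*} [CommSemiring S] [Algebra S R]
    {w : σ → S} {μ : S} {f : MvPolynomial σ R} (hf : IsWeightedHomogeneous w f μ) :
    ∑ i, w i • (X i * pderiv i f) = μ • f := by
  rw [f.as_sum]
  simp only [map_sum, Finset.mul_sum, Finset.smul_sum]
  rw [Finset.sum_comm]
  refine Finset.sum_congr rfl fun s hs => ?_
  rw [← hf (mem_support_iff.mp hs), Finsupp.weight_apply, Finsupp.sum_fintype _ _ (by simp),
    Finset.sum_smul]
  refine Finset.sum_congr rfl fun i _ => ?_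
  rw [X_mul_pderiv_monomial, smul_assoc, smul_comm]

end Polynomials

section Circle

open Complex (I)

open scoped ComplexConjugate

lemma re_eval_le_zero {R : Polynomial ℂ} (hR : ∀ t : ℂ, ‖t‖ = 1 → (R.eval t).re = 0) {t : ℂ}
    (ht : ‖t‖ < 1) : (R.eval t).re ≤ 0 := by
  have hbound : ‖Complex.exp (R.eval t)‖ ≤ 1 :=
    Complex.norm_le_of_forall_mem_frontier_norm_le Metric.isBounded_ball
      (U := Metric.ball (0 : ℂ) 1) (f := fun s => Complex.exp (R.eval s))
      (R.differentiable.cexp.diffContOnCl)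
      (fun s hs => by
        rw [frontier_ball _ one_ne_zero, mem_sphere_zero_iff_norm] at hs
        simp [Complex.norm_exp, hR s hs])
      (subset_closure (mem_ball_zero_iff.mpr ht))
  simpa [Complex.norm_exp] using hbound

/-- By the maximum principle the real part vanishes on the disc as well. -/
lemma exists_eq_C_of_re_eq_zero {R : Polynomial ℂ}
    (hR : ∀ t : ℂ, ‖t‖ = 1 → (R.eval t).re = 0) : ∃ c : ℂ, c.re = 0 ∧ R = Polynomial.C c := by
  have hre : ∀ t ∈ Metric.ball (0 : ℂ) 1, (R.eval t).re = 0 := fun t ht => by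
    have hneg : ((-R).eval t).re ≤ 0 :=
      re_eval_le_zero (fun s hs => by simp [hR s hs]) (mem_ball_zero_iff.mp ht)
    refine le_antisymm (re_eval_le_zero hR (mem_ball_zero_iff.mp ht)) ?_
    simpa using hneg
  obtain ⟨c, hc⟩ := AnalyticOnNhd.eq_const_of_re_eq_const
    (fun t _ => R.differentiable.analyticAt t) hre Metric.isOpen_ball
    (Metric.isConnected_ball one_pos)
  have h0 : (0 : ℂ) ∈ Metric.ball (0 : ℂ) 1 := Metric.mem_ball_self one_pos
  refine ⟨c, hc 0 h0 ▸ hre 0 h0, Polynomial.eq_of_infinite_eval_eq _ _ ?_⟩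
  exact (infinite_of_mem_nhds 0 (Metric.isOpen_ball.mem_nhds h0)).mono fun t ht => by
    simpa using hc t ht

lemma coeff_eq_of_im_eval_eq {P Q : Polynomial ℂ}
    (h : ∀ t : ℂ, ‖t‖ = 1 → (P.eval t).im = 2 * (conj t * Q.eval t).re) :
    (P.coeff 0).im = 2 * (Q.coeff 1).re ∧ P.coeff 1 = 2 * I * (Q.coeff 2 + conj (Q.coeff 0)) := by
  -- On the circle `t̄ Q(t)` has the same real part as `Q.divX(t) + conj (Q.coeff 0) t`.
  have hre : ∀ t : ℂ, ‖t‖ = 1 → ((Polynomial.C (-I) * P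
      - Polynomial.C (2 * conj (Q.coeff 0)) * Polynomial.X - 2 * Q.divX).eval t).re = 0 := by
    intro t ht
    have ht' : conj t * t = 1 := by
      rw [Complex.conj_mul', ht, Complex.ofReal_one, one_pow]
    have hQ : conj t * Q.eval t = Q.divX.eval t + conj t * Q.coeff 0 := by
      conv_lhs => rw [← Polynomial.divX_mul_X_add Q]
      simp only [Polynomial.eval_add, Polynomial.eval_mul, Polynomial.eval_X, Polynomial.eval_C]
      linear_combination Q.divX.eval t * ht'
    have him : (P.eval t).im
        = 2 * ((Q.divX.eval t).re + (t.re * (Q.coeff 0).re + t.im * (Q.coeff 0).im)) := by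
      simpa [hQ] using h t ht
    simp only [Polynomial.eval_sub, Polynomial.eval_mul, Polynomial.eval_C, Polynomial.eval_X,
      Polynomial.eval_ofNat, Complex.sub_re, Complex.mul_re, Complex.mul_im, Complex.neg_re,
      Complex.neg_im, Complex.I_re, Complex.I_im, Complex.re_ofNat, Complex.im_ofNat,
      Complex.conj_re, Complex.conj_im]
    linarith
  obtain ⟨c, hc, hconst⟩ := exists_eq_C_of_re_eq_zero hre
  have h0 : (P.coeff 0).im - 2 * (Q.coeff 1).re = 0 := by
    simpa [mul_assoc, Polynomial.coeff_divX, hc] using congrArg (fun p => (p.coeff 0).re) hconst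
  have h1 : -(I * P.coeff 1) - 2 * conj (Q.coeff 0) - 2 * Q.coeff 2 = 0 := by
    simpa [mul_assoc, Polynomial.coeff_divX] using congrArg (fun p => p.coeff 1) hconst
  exact ⟨by linarith, by linear_combination I * h1 + P.coeff 1 * Complex.I_mul_I⟩

end Circle

section IdentityTheorems

open Filter

open Complex (I)

variable {E F : Type*} [NormedAddCommGroup E] [NormedSpace ℂ E]
  [NormedAddCommGroup F] [NormedSpace ℂ F]

lemma eq_zero_of_eventually_ofReal_eq_zero [CompleteSpace F] {g : ℂ → F} (hg : Differentiable ℂ g)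
    (h : ∀ᶠ t : ℝ in 𝓝 0, g t = 0) (t : ℂ) : g t = 0 := by
  have hreal : Tendsto ((↑) : ℝ → ℂ) (𝓝[≠] 0) (𝓝[≠] 0) :=
    tendsto_nhdsWithin_iff.mpr ⟨(Complex.continuous_ofReal.tendsto' 0 0 (by simp)).mono_left
      nhdsWithin_le_nhds, by filter_upwards [self_mem_nhdsWithin] with t ht using by simpa using ht⟩
  exact congrFun (AnalyticOnNhd.eq_of_frequently_eq (z₀ := 0) (fun t _ => hg.analyticAt t)
    analyticOnNhd_const (hreal.frequently (h.filter_mono nhdsWithin_le_nhds).frequently)) t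

lemma eq_zero_of_eventually_eq_zero [CompleteSpace F] {f : E → F} (hf : Differentiable ℂ f) {x₀ : E}
    (h : ∀ᶠ x in 𝓝 x₀, f x = 0) (x : E) : f x = 0 := by
  have hline : Continuous fun t : ℝ => x₀ + (t : ℂ) • (x - x₀) := by fun_prop
  have hzero : ∀ᶠ t : ℝ in 𝓝 0, f (x₀ + (t : ℂ) • (x - x₀)) = 0 :=
    (hline.tendsto' 0 x₀ (by simp)).eventually h
  simpa using eq_zero_of_eventually_ofReal_eq_zero
    (g := fun t => f (x₀ + t • (x - x₀))) (by fun_prop) hzero 1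

lemma eq_zero_of_smul_eq_zero [CompleteSpace F] {f : E → ℂ} {g : E → F}
    (hf : Continuous f) (hg : Differentiable ℂ g) (h : ∀ x, f x • g x = 0)
    {x₀ : E} (h₀ : f x₀ ≠ 0) (x : E) : g x = 0 :=
  eq_zero_of_eventually_eq_zero hg
    ((hf.continuousAt.eventually_ne h₀).mono fun x hx => (smul_eq_zero.mp (h x)).resolve_left hx) x

/-- On the complex line through `((z̄ + ζ) / 2, (z + ζ̄) / 2)` with direction
`((ζ - z̄) / 2i, (z - ζ̄) / 2i)` the real points are conjugate pairs. -/
lemma eq_zero_of_apply_star_eq_zero {ι : Type*} [Finite ι] [CompleteSpace F]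
    {f : (ι → ℂ) → (ι → ℂ) → F}
    (hf : Differentiable ℂ fun p : (ι → ℂ) × (ι → ℂ) => f p.1 p.2)
    (h : ∀ z, f (star z) z = 0) (ζ z : ι → ℂ) : f ζ z = 0 := by
  have := Fintype.ofFinite ι
  let p : ι → ℂ := (2⁻¹ : ℂ) • (z + star ζ)
  let q : ι → ℂ := (-2⁻¹ * I) • (z - star ζ)
  let line : ℂ → (ι → ℂ) × (ι → ℂ) := fun t => (star p + t • star q, p + t • q)
  have hline : Differentiable ℂ line := by fun_prop
  have hreal : ∀ t : ℝ, f (line t).1 (line t).2 = 0 := fun t => by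
    have : (line t).1 = star (line t).2 := by
      ext i
      simp [line]
    rw [this, h]
  have hI : line I = (ζ, z) := by
    have hp : ∀ a b : ℂ, 2⁻¹ * (a + b) + I * (-2⁻¹ * I * (a - b)) = a := fun a b => by
      linear_combination -2⁻¹ * (a - b) * Complex.I_mul_I
    have hq : ∀ a b : ℂ, 2⁻¹ * (b + a) + I * (2⁻¹ * I * (b - a)) = a := fun a b => by
      linear_combination 2⁻¹ * (b - a) * Complex.I_mul_I
    ext i
    · simpa [line, p, q, mul_add] using hq (ζ i) (star (z i))
    · simpa [line, p, q, mul_add] using hp (z i) (star (ζ i))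
  simpa [hI] using eq_zero_of_eventually_ofReal_eq_zero (hf.comp hline) (.of_forall hreal) I

end IdentityTheorems

section Weights

variable {n d : ℕ}

lemma weight_wt (s : Fin n ⊕ Fin d →₀ ℕ) :
    Finsupp.weight (wt n d) s
      = ((∑ j, s (Sum.inl j) : ℕ) : ℚ) / 2 + ((∑ l, s (Sum.inr l) : ℕ) : ℚ) := by
  rw [Finsupp.weight_apply, Finsupp.sum_fintype _ _ (by simp), Fintype.sum_sum_type]
  simp [wt, ← Finset.sum_mul, div_eq_mul_inv]

lemma eq_zero_of_weight_neg {f : Poly n d} {μ : ℚ} (hf : IsWeightedHomogeneous (wt n d) f μ)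
    (hμ : μ < 0) : f = 0 := by
  ext s
  by_contra hs
  have hweight := hf hs
  rw [weight_wt] at hweight
  have : (0 : ℚ) ≤ μ := hweight ▸ by positivity
  linarith

lemma eq_C_of_weight_zero {f : Poly n d} (hf : IsWeightedHomogeneous (wt n d) f 0) :
    f = C (eval 0 f) := by
  ext s
  rw [coeff_C, eval_zero, constantCoeff_eq]
  split_ifs with hs
  · rw [hs]
  · by_contra hne
    have hweight := hf hne
    rw [weight_wt, add_eq_zero_iff_of_nonneg (by positivity) (by positivity)] at hweight
    have hz : ∀ j, s (Sum.inl j) = 0 := by simpa [-Nat.cast_sum] using hweight.1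
    have hw : ∀ l, s (Sum.inr l) = 0 := by simpa [-Nat.cast_sum] using hweight.2
    exact hs (Finsupp.ext (Sum.rec (fun j => (hz j).symm) fun l => (hw l).symm))

lemma eval_zero_of_weight_ne_zero {f : Poly n d} {μ : ℚ}
    (hf : IsWeightedHomogeneous (wt n d) f μ) (hμ : μ ≠ 0) : eval 0 f = 0 := by
  rw [eval_zero]
  by_contra h0
  exact hμ (by simpa using (hf h0).symm)

lemma mul_eval_eq_sum_pderiv {f : Poly n d} {μ : ℚ} (hf : IsWeightedHomogeneous (wt n d) f μ)
    (z : Fin n → ℂ) (w : Fin d → ℂ) :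
    μ * eval (Sum.elim z w) f
      = 2⁻¹ * ∑ j, z j * eval (Sum.elim z w) (pderiv (Sum.inl j) f)
        + ∑ l, w l * eval (Sum.elim z w) (pderiv (Sum.inr l) f) := by
  have h := congrArg (eval (Sum.elim z w)) (sum_weight_smul_X_mul_pderiv hf)
  simp only [Algebra.smul_def] at h
  simpa [wt, Finset.mul_sum, smul_eval] using h.symm

/-- The restriction `t ↦ f (t z, w)`, whose coefficients are the parts of `f` homogeneous in the
variables `z`. -/
noncomputable def slice (f : Poly n d) (z : Fin n → ℂ) (w : Fin d → ℂ) : Polynomial ℂ :=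
  restrictLine f (Sum.elim 0 w) (Sum.elim z 0)

lemma eval_slice (f : Poly n d) (z : Fin n → ℂ) (w : Fin d → ℂ) (t : ℂ) :
    (slice f z w).eval t = eval (Sum.elim (t • z) w) f := by
  rw [slice, eval_restrictLine]
  congr 2
  ext (j | l) <;> simp

lemma slice_coeff_zero (f : Poly n d) (z : Fin n → ℂ) (w : Fin d → ℂ) :
    (slice f z w).coeff 0 = eval (Sum.elim 0 w) f :=
  restrictLine_coeff_zero ..

lemma slice_coeff_one (f : Poly n d) (z : Fin n → ℂ) (w : Fin d → ℂ) :
    (slice f z w).coeff 1 = ∑ j, z j * eval (Sum.elim 0 w) (pderiv (Sum.inl j) f) := by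
  simp [slice, restrictLine_coeff_one]

lemma slice_coeff_eq_sum (f : Poly n d) (z : Fin n → ℂ) (w : Fin d → ℂ) (k : ℕ) :
    (slice f z w).coeff k = ∑ s ∈ f.support with ∑ j, s (Sum.inl j) = k,
      f.coeff s * (∏ j, z j ^ s (Sum.inl j)) * ∏ l, w l ^ s (Sum.inr l) := by
  have hmonomial : ∀ s : Fin n ⊕ Fin d →₀ ℕ,
      Polynomial.C (f.coeff s) * ∏ i, (Polynomial.C (Sum.elim 0 w i)
        + Polynomial.C (Sum.elim z 0 i) * Polynomial.X) ^ s i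
      = Polynomial.C (f.coeff s * (∏ j, z j ^ s (Sum.inl j)) * ∏ l, w l ^ s (Sum.inr l))
        * Polynomial.X ^ ∑ j, s (Sum.inl j) := fun s => by
    simp [Fintype.prod_sum_type, mul_pow, Finset.prod_mul_distrib, Finset.prod_pow_eq_pow_sum,
      mul_right_comm _ (Polynomial.X ^ _), mul_assoc]
  rw [slice, restrictLine, aeval_def, eval₂_eq', Finset.sum_filter]
  simp only [Polynomial.algebraMap_eq, hmonomial, Polynomial.finsetSum_coeff,
    Polynomial.coeff_C_mul_X_pow, eq_comm]

lemma slice_coeff_smul {f : Poly n d} {m k : ℕ}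
    (hf : IsWeightedHomogeneous (wt n d) f (m + k / 2)) (z : Fin n → ℂ) (w : Fin d → ℂ) (c : ℂ) :
    (slice f z (c • w)).coeff k = c ^ m * (slice f z w).coeff k := by
  simp only [slice_coeff_eq_sum, Finset.mul_sum]
  refine Finset.sum_congr rfl fun s hs => ?_
  obtain ⟨hsupp, hk⟩ := Finset.mem_filter.mp hs
  have hm : ∑ l, s (Sum.inr l) = m := by
    have hweight := hf (mem_support_iff.mp hsupp)
    rw [weight_wt, hk, add_comm] at hweight
    exact_mod_cast add_right_cancel hweight
  simp only [Pi.smul_apply, smul_eq_mul, mul_pow, Finset.prod_mul_distrib,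
    Finset.prod_pow_eq_pow_sum, hm]
  ring

end Weights

section Forms

variable {ι κ : Type*} [Fintype ι]

lemma linearIndependent_complex_of_real {V : Type*} [AddCommGroup V] [Module ℂ V] [StarAddMonoid V]
    [StarModule ℂ V] {v : κ → V} (hv : ∀ l, IsSelfAdjoint (v l)) (h : LinearIndependent ℝ v) :
    LinearIndependent ℂ v := by
  rw [linearIndependent_iff'] at h ⊢
  intro s c hc l hl
  have hre : ∑ l ∈ s, (c l).re • v l = 0 := by
    have := congrArg (fun x => (realPart x : V)) hc
    simpa [realPart_smul, (hv _).coe_realPart, (hv _).imaginaryPart] using this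
  have him : ∑ l ∈ s, (c l).im • v l = 0 := by
    have := congrArg (fun x => (imaginaryPart x : V)) hc
    simpa [imaginaryPart_smul, (hv _).coe_realPart, (hv _).imaginaryPart] using this
  exact Complex.ext (h s _ hre l hl) (h s _ him l hl)

lemma star_dotProduct_mulVec {R : Type*} [CommSemiring R] [StarRing R] (M : Matrix ι ι R)
    (ζ z : ι → R) :
    star (ζ ⬝ᵥ M *ᵥ z) = star z ⬝ᵥ Mᴴ *ᵥ star ζ := by
  rw [← Matrix.star_dotProduct_star, Matrix.star_mulVec, Matrix.dotProduct_mulVec]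

lemma matrix_ext_dotProduct {R : Type*} [CommSemiring R] {M N : Matrix ι ι R}
    (h : ∀ ζ z, ζ ⬝ᵥ M *ᵥ z = ζ ⬝ᵥ N *ᵥ z) : M = N :=
  Matrix.ext_iff_mulVec.mpr fun z => dotProduct_eq _ _ fun ζ => by
    rw [dotProduct_comm, h, dotProduct_comm]

lemma exists_dotProduct_mulVec_ne_zero {R : Type*} [CommSemiring R] {M : Matrix ι ι R}
    (hM : M ≠ 0) :
    ∃ ζ z, ζ ⬝ᵥ M *ᵥ z ≠ 0 := by
  by_contra! hzero
  exact hM (matrix_ext_dotProduct fun ζ z => by simp [hzero])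

@[fun_prop]
lemma differentiable_dotProduct_mulVec {E : Type*} [NormedAddCommGroup E] [NormedSpace ℂ E]
    {f g : E → ι → ℂ} (hf : Differentiable ℂ f) (hg : Differentiable ℂ g) (M : Matrix ι ι ℂ) :
    Differentiable ℂ fun x => f x ⬝ᵥ M *ᵥ g x := by
  simp only [dotProduct, Matrix.mulVec]
  fun_prop

lemma matrix_eq_zero_of_star_dotProduct {M : Matrix ι ι ℂ} (h : ∀ z, star z ⬝ᵥ M *ᵥ z = 0) :
    M = 0 :=
  matrix_ext_dotProduct fun ζ z => by
    rw [eq_zero_of_apply_star_eq_zero (f := fun ζ z => ζ ⬝ᵥ M *ᵥ z) (by fun_prop) h]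
    simp

lemma conjTranspose_eq_neg_of_re_eq_zero {M : Matrix ι ι ℂ}
    (h : ∀ z, (star z ⬝ᵥ M *ᵥ z).re = 0) : Mᴴ = -M := by
  refine eq_neg_of_add_eq_zero_left (matrix_eq_zero_of_star_dotProduct fun z => ?_)
  have hstar := star_dotProduct_mulVec M (star z) z
  rw [star_star] at hstar
  rw [Matrix.add_mulVec, dotProduct_add, ← hstar, add_comm, Complex.star_def, Complex.add_conj, h]
  simp

lemma exists_eq_smul_of_minors_eq_zero {M N : Matrix ι ι ℂ} (hM : M.IsHermitian)
    (hN : N.IsHermitian) (hN0 : N ≠ 0)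
    (h : ∀ ζ z z', (ζ ⬝ᵥ M *ᵥ z) * (ζ ⬝ᵥ N *ᵥ z') = (ζ ⬝ᵥ M *ᵥ z') * (ζ ⬝ᵥ N *ᵥ z)) :
    ∃ c : ℂ, M = c • N := by
  have hcol : ∀ ζ ζ' z, (ζ ⬝ᵥ M *ᵥ z) * (ζ' ⬝ᵥ N *ᵥ z) = (ζ' ⬝ᵥ M *ᵥ z) * (ζ ⬝ᵥ N *ᵥ z) := by
    intro ζ ζ' z
    have := congrArg star (h (star z) (star ζ) (star ζ'))
    simpa only [star_mul', star_dotProduct_mulVec, hM.eq, hN.eq, star_star] using this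
  obtain ⟨ζ₀, z₀, h₀⟩ := exists_dotProduct_mulVec_ne_zero hN0
  refine ⟨(ζ₀ ⬝ᵥ M *ᵥ z₀) / (ζ₀ ⬝ᵥ N *ᵥ z₀), matrix_ext_dotProduct fun ζ z => ?_⟩
  have hprop := eq_zero_of_smul_eq_zero (f := fun ζ => ζ ⬝ᵥ N *ᵥ z₀)
    (g := fun ζ => (ζ ⬝ᵥ M *ᵥ z) * (ζ₀ ⬝ᵥ N *ᵥ z₀) - (ζ₀ ⬝ᵥ M *ᵥ z₀) * (ζ ⬝ᵥ N *ᵥ z))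
    (Differentiable.continuous (𝕜 := ℂ) (by fun_prop)) (by fun_prop)
    (fun ζ => by
      rw [smul_eq_mul]
      linear_combination (ζ₀ ⬝ᵥ N *ᵥ z₀) * h ζ z z₀ + (ζ ⬝ᵥ N *ᵥ z) * hcol ζ ζ₀ z₀) h₀ ζ
  rw [Matrix.smul_mulVec, dotProduct_smul, smul_eq_mul]
  field_simp
  linear_combination hprop

end Forms

section GenericIndependence

open Filter

variable {ι κ : Type*} [Fintype ι] {A : κ → Matrix ι ι ℂ}

/-- The polarizations `(ζ, z) ↦ ᵗζ A_l z` of the forms `ᵗz̄ A_l z`, as one vector-valued map. -/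
def polarForm (A : κ → Matrix ι ι ℂ) (ζ z : ι → ℂ) : κ → ℂ := fun l => ζ ⬝ᵥ A l *ᵥ z

/-- The linear forms `z ↦ ᵗζ A_l z` are linearly independent for some, hence for generic, `ζ`.
This is what the uniqueness arguments use of a nondegenerate quadric, and in codimension two it
follows from nondegeneracy. -/
def GenericallyIndependent (A : κ → Matrix ι ι ℂ) : Prop :=
  ∃ ζ, LinearIndependent ℂ fun l => ζ ᵥ* A l

@[fun_prop]
lemma differentiable_polarForm (A : κ → Matrix ι ι ℂ) :
    Differentiable ℂ fun p : (ι → ℂ) × (ι → ℂ) => polarForm A p.1 p.2 := by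
  unfold polarForm
  fun_prop

variable [Finite κ]

lemma polarForm_surjective {ζ : ι → ℂ} (hζ : LinearIndependent ℂ fun l => ζ ᵥ* A l) :
    Function.Surjective (polarForm A ζ) := by
  have := Fintype.ofFinite κ
  let M : Matrix κ ι ℂ := Matrix.of fun l => ζ ᵥ* A l
  have hrange : LinearMap.range M.mulVecLin = ⊤ := Submodule.eq_top_of_finrank_eq <| by
    rw [← Matrix.rank, LinearIndependent.rank_matrix (M := M) hζ,
      Module.finrank_fintype_fun_eq_card]
  intro w
  obtain ⟨z, hz⟩ := LinearMap.range_eq_top.mp hrange w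
  refine ⟨z, funext fun l => ?_⟩
  rw [polarForm, Matrix.dotProduct_mulVec, ← hz]
  rfl

lemma eventually_linearIndependent {ζ₀ : ι → ℂ} (hζ : LinearIndependent ℂ fun l => ζ₀ ᵥ* A l) :
    ∀ᶠ ζ in 𝓝 ζ₀, LinearIndependent ℂ fun l => ζ ᵥ* A l := by
  have := Fintype.ofFinite κ
  have hcont : Continuous fun (ζ : ι → ℂ) (l : κ) => ζ ᵥ* A l := by fun_prop
  exact hcont.continuousAt.eventually hζ.eventually

variable {F : Type*} [NormedAddCommGroup F] [NormedSpace ℂ F] [CompleteSpace F]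

lemma GenericallyIndependent.eq_zero_of_polarForm (hA : GenericallyIndependent A)
    {g : (κ → ℂ) → F} (hg : Differentiable ℂ g) (h : ∀ z, g (polarForm A (star z) z) = 0)
    (w : κ → ℂ) : g w = 0 := by
  have := Fintype.ofFinite κ
  obtain ⟨ζ, hζ⟩ := hA
  obtain ⟨z, rfl⟩ := polarForm_surjective hζ w
  exact eq_zero_of_apply_star_eq_zero (f := fun ζ z => g (polarForm A ζ z)) (by fun_prop) h ζ z

lemma GenericallyIndependent.eq_zero_of_polarForm_apply (hA : GenericallyIndependent A)
    (hker : ∀ z, (∀ l, A l *ᵥ z = 0) → z = 0) {f : (κ → ℂ) → ι → ℂ} (hf : Differentiable ℂ f)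
    (h : ∀ z, polarForm A (star z) (f (polarForm A (star z) z)) = 0) (w : κ → ℂ) : f w = 0 := by
  have := Fintype.ofFinite κ
  have hpolar := eq_zero_of_apply_star_eq_zero
    (f := fun ζ z => polarForm A ζ (f (polarForm A ζ z))) (by unfold polarForm; fun_prop) h
  obtain ⟨ζ₀, hζ₀⟩ := hA
  have hnear : ∀ᶠ ζ in 𝓝 ζ₀, polarForm A ζ (f w) = 0 :=
    (eventually_linearIndependent hζ₀).mono fun ζ hζ => by
      obtain ⟨z, rfl⟩ := polarForm_surjective hζ w
      exact hpolar ζ z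
  refine hker _ fun l => dotProduct_eq_zero _ fun ζ => ?_
  rw [dotProduct_comm]
  exact congrFun (eq_zero_of_eventually_eq_zero (by unfold polarForm; fun_prop) hnear ζ) l

lemma mul_minor_of_not_linearIndependent {K : Type*} [Field K] {v : Fin 2 → ι → K}
    (hv : ¬LinearIndependent K v) (x y : ι → K) :
    (v 0 ⬝ᵥ x) * (v 1 ⬝ᵥ y) = (v 0 ⬝ᵥ y) * (v 1 ⬝ᵥ x) := by
  rw [Fintype.not_linearIndependent_iff] at hv
  obtain ⟨c, hc, l, hl⟩ := hv
  rw [Fin.sum_univ_two] at hc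
  have hx : c 0 * (v 0 ⬝ᵥ x) + c 1 * (v 1 ⬝ᵥ x) = 0 := by
    simpa [add_dotProduct] using congrArg (· ⬝ᵥ x) hc
  have hy : c 0 * (v 0 ⬝ᵥ y) + c 1 * (v 1 ⬝ᵥ y) = 0 := by
    simpa [add_dotProduct] using congrArg (· ⬝ᵥ y) hc
  refine mul_left_cancel₀ hl ?_
  fin_cases l <;> simp only [Fin.zero_eta, Fin.mk_one]
  · linear_combination (v 1 ⬝ᵥ y) * hx - (v 1 ⬝ᵥ x) * hy
  · linear_combination (v 0 ⬝ᵥ x) * hy - (v 0 ⬝ᵥ y) * hx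

end GenericIndependence

section Codimension2

variable {n : ℕ} {A : Fin 2 → Matrix (Fin n) (Fin n) ℂ}

lemma Nondegenerate.linearIndependent_complex {d : ℕ} {A : Fin d → Matrix (Fin n) (Fin n) ℂ}
    (hA : Nondegenerate A) : LinearIndependent ℂ A :=
  linearIndependent_complex_of_real hA.isHermitian hA.linearIndependent

lemma eq_zero_of_smul_add_smul_eq_zero {K V : Type*} [Ring K] [AddCommGroup V] [Module K V]
    {v : Fin 2 → V} (hv : LinearIndependent K v) {a b : K} (h : a • v 0 + b • v 1 = 0) :
    a = 0 ∧ b = 0 := by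
  have hzero := Fintype.linearIndependent_iff.mp hv ![a, b] (by simpa using h)
  exact ⟨hzero 0, hzero 1⟩

lemma Nondegenerate.genericallyIndependent (hA : Nondegenerate A) : GenericallyIndependent A := by
  by_contra hdep
  obtain ⟨c, hc⟩ := exists_eq_smul_of_minors_eq_zero (hA.isHermitian 0) (hA.isHermitian 1)
    (hA.linearIndependent.ne_zero 1) fun ζ z z' => by
      simpa only [Matrix.dotProduct_mulVec] using
        mul_minor_of_not_linearIndependent (not_exists.mp hdep ζ) z z'
  simpa using (eq_zero_of_smul_add_smul_eq_zero hA.linearIndependent_complex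
    (a := 1) (b := -c) (by rw [hc]; module)).1

lemma apply_mul_apply_comm_of_surjective {K V : Type*} [Field K] [AddCommGroup V] [Module K V]
    {a b : Fin 2 → V →ₗ[K] K} (ha : ∀ w : Fin 2 → K, ∃ v, ∀ l, a l v = w l)
    (h : ∀ v, ∑ l, a l v * b l v = 0) (v v' : V) : b 0 v * a 1 v' = b 0 v' * a 1 v := by
  simp only [Fin.sum_univ_two] at h
  obtain ⟨x, hx⟩ := ha ![1, 0]
  obtain ⟨y, hy⟩ := ha ![0, 1]
  have hx0 : a 0 x = 1 := hx 0
  have hx1 : a 1 x = 0 := hx 1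
  have hy1 : a 1 y = 1 := hy 1
  have hbx : b 0 x = 0 := by simpa [hx0, hx1] using h x
  have hker : ∀ u, a 1 u = 0 → b 0 u = 0 := by
    intro u hu
    by_cases hu0 : a 0 u = 0
    · simpa [hu, hu0, hx0, hx1, hbx] using h (u + x)
    · simpa [hu, hu0] using h u
  have hmul : ∀ u, b 0 u = a 1 u * b 0 y := fun u => by
    simpa [hy1, sub_eq_zero] using hker (u - a 1 u • y) (by simp [hy1])
  rw [hmul v, hmul v']
  ring

lemma minors_eq_zero_of_sum_mul_eq_zero (hA : GenericallyIndependent A)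
    {B : Fin 2 → Matrix (Fin n) (Fin n) ℂ}
    (h : ∀ ζ z, ∑ k, (ζ ⬝ᵥ A k *ᵥ z) * (ζ ⬝ᵥ B k *ᵥ z) = 0) (ζ z z' : Fin n → ℂ) :
    (ζ ⬝ᵥ B 0 *ᵥ z) * (ζ ⬝ᵥ A 1 *ᵥ z') = (ζ ⬝ᵥ B 0 *ᵥ z') * (ζ ⬝ᵥ A 1 *ᵥ z) := by
  obtain ⟨ζ₀, hζ₀⟩ := hA
  refine sub_eq_zero.mp (eq_zero_of_eventually_eq_zero (x₀ := ζ₀) (f := fun ζ =>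
    (ζ ⬝ᵥ B 0 *ᵥ z) * (ζ ⬝ᵥ A 1 *ᵥ z') - (ζ ⬝ᵥ B 0 *ᵥ z') * (ζ ⬝ᵥ A 1 *ᵥ z)) (by fun_prop) ?_ ζ)
  filter_upwards [eventually_linearIndependent hζ₀] with ζ hζ
  let form (M : Matrix (Fin n) (Fin n) ℂ) : (Fin n → ℂ) →ₗ[ℂ] ℂ :=
    dotProductBilin ℂ ℂ ζ ∘ₗ M.mulVecLin
  exact sub_eq_zero.mpr (apply_mul_apply_comm_of_surjective
    (a := fun k => form (A k)) (b := fun k => form (B k))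
    (fun w => (polarForm_surjective hζ w).imp fun z hz l => congrFun hz l) (h ζ) z z')

lemma exists_eq_smul_of_sum_mul_eq_zero (hA : Nondegenerate A)
    {S : Fin 2 → Matrix (Fin n) (Fin n) ℂ} (hskew : (S 0)ᴴ = -S 0)
    (h : ∀ ζ z, ∑ k, (ζ ⬝ᵥ A k *ᵥ z) * (ζ ⬝ᵥ S k *ᵥ z) = 0) :
    ∃ c : ℂ, S 0 = c • A 1 ∧ S 1 = -c • A 0 := by
  have hA₁ : A 1 ≠ 0 := hA.linearIndependent.ne_zero 1
  obtain ⟨c, hc⟩ := exists_eq_smul_of_minors_eq_zero (M := Complex.I • S 0)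
    (by simp [Matrix.IsHermitian, hskew]) (hA.isHermitian 1) hA₁ fun ζ z z' => by
      simp only [Matrix.smul_mulVec, dotProduct_smul, smul_eq_mul]
      linear_combination
        Complex.I * minors_eq_zero_of_sum_mul_eq_zero hA.genericallyIndependent h ζ z z'
  have hS₀ : S 0 = (-Complex.I * c) • A 1 := by
    simp [mul_smul, ← hc, smul_smul]
  refine ⟨-Complex.I * c, hS₀, eq_of_sub_eq_zero (matrix_ext_dotProduct fun ζ z => ?_)⟩
  obtain ⟨ζ₁, z₁, h₁⟩ := exists_dotProduct_mulVec_ne_zero hA₁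
  rw [Matrix.zero_mulVec, dotProduct_zero]
  refine eq_zero_of_smul_eq_zero (x₀ := (ζ₁, z₁)) (x := (ζ, z))
    (f := fun p : (Fin n → ℂ) × (Fin n → ℂ) => p.1 ⬝ᵥ A 1 *ᵥ p.2)
    (g := fun p => p.1 ⬝ᵥ (S 1 - -(-Complex.I * c) • A 0) *ᵥ p.2)
    (Differentiable.continuous (𝕜 := ℂ) (by fun_prop)) (by fun_prop) (fun p => ?_) h₁
  have hp := h p.1 p.2
  simp only [Fin.sum_univ_two, hS₀, Matrix.smul_mulVec, Matrix.sub_mulVec, dotProduct_sub,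
    dotProduct_smul, smul_eq_mul] at hp ⊢
  linear_combination hp

/-- Evaluating `A_l B_0 B_1` in two ways, once by skewness, gives `c_l (c_1 A_0 - c_0 A_1) = 0`. -/
lemma eq_zero_of_mul_skew (hA : Nondegenerate A) {B : Fin 2 → Matrix (Fin n) (Fin n) ℂ}
    (hskew : ∀ l, (A l * B 0)ᴴ = -(A l * B 0))
    (h : ∀ l ζ z, ∑ k, (ζ ⬝ᵥ A k *ᵥ z) * (ζ ⬝ᵥ (A l * B k) *ᵥ z) = 0) (k : Fin 2) : B k = 0 := by
  choose c h₀ h₁ using fun l =>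
    exists_eq_smul_of_sum_mul_eq_zero hA (S := fun k => A l * B k) (hskew l) (h l)
  have hadj : ∀ l, (B 0)ᴴ * A l = -(A l * B 0) := fun l => by
    rw [← hskew, Matrix.conjTranspose_mul, (hA.isHermitian l).eq]
  have hc : ∀ l, c l = 0 := by
    intro l
    have hright : A l * B 0 * B 1 = -(c l * c 1) • A 0 := by
      rw [h₀, Matrix.smul_mul, h₁]; module
    have hleft : A l * B 0 * B 1 = -(c l * c 0) • A 1 := by
      rw [← neg_neg (A l * B 0), ← hadj, Matrix.neg_mul, Matrix.mul_assoc, h₁, Matrix.mul_smul,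
        hadj, h₀]
      module
    obtain ⟨hc₁, hc₀⟩ := eq_zero_of_smul_add_smul_eq_zero hA.linearIndependent_complex
      (a := -(c l * c 1)) (b := c l * c 0) (by rw [← hright, hleft]; module)
    fin_cases l <;> simp_all
  have hzero : ∀ l, A l * B k = 0 := fun l => by
    fin_cases k
    exacts [by simp [h₀, hc], by simp [h₁, hc]]
  refine Matrix.ext_iff_mulVec.mpr fun z => ?_
  rw [Matrix.zero_mulVec]
  exact hA.ker_inter _ fun l => by rw [Matrix.mulVec_mulVec, hzero, Matrix.zero_mulVec]

end Codimension2

section Tangency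

open Complex (I)

open scoped ComplexConjugate

variable {n d : ℕ} {A : Fin d → Matrix (Fin n) (Fin n) ℂ}

lemma mem_quadric_iff {p : Ambient n d} : p ∈ quadric A ↔ ∀ l, (p.2 l).im = hermForm (A l) p.1 :=
  forall_congr' fun _ => sub_eq_zero

lemma ofReal_hermForm {M : Matrix (Fin n) (Fin n) ℂ} (hM : M.IsHermitian) (z : Fin n → ℂ) :
    (hermForm M z : ℂ) = star z ⬝ᵥ M *ᵥ z := by
  refine Complex.conj_eq_iff_re.mp ?_
  rw [starRingEnd_apply, star_dotProduct_mulVec, hM.eq, star_star]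

lemma polarForm_star (hA : ∀ l, (A l).IsHermitian) (z : Fin n → ℂ) :
    polarForm A (star z) z = fun l => (hermForm (A l) z : ℂ) :=
  funext fun l => (ofReal_hermForm (hA l) z).symm

lemma hermForm_smul (M : Matrix (Fin n) (Fin n) ℂ) (t : ℂ) (z : Fin n → ℂ) :
    hermForm M (t • z) = ‖t‖ ^ 2 * hermForm M z := by
  simp only [hermForm, Matrix.mulVec_smul, star_smul, smul_dotProduct, dotProduct_smul,
    smul_eq_mul, ← mul_assoc, Complex.star_def]
  rw [Complex.mul_conj', ← Complex.ofReal_pow, Complex.re_ofReal_mul]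

lemma hermForm_add_smul {M : Matrix (Fin n) (Fin n) ℂ} (hM : M.IsHermitian) (z v : Fin n → ℂ)
    (t : ℝ) : hermForm M (z + (t : ℂ) • v)
      = hermForm M z + t * (2 * (star z ⬝ᵥ M *ᵥ v).re) + t ^ 2 * hermForm M v := by
  have hcross : (star v ⬝ᵥ M *ᵥ z).re = (star z ⬝ᵥ M *ᵥ v).re := by
    rw [← Complex.conj_re, starRingEnd_apply, star_dotProduct_mulVec, hM.eq, star_star]
  simp only [hermForm, Matrix.mulVec_add, Matrix.mulVec_smul, star_add, star_smul,
    add_dotProduct, dotProduct_add, smul_dotProduct, dotProduct_smul, smul_eq_mul, Complex.add_re,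
    Complex.star_def, Complex.conj_ofReal, Complex.re_ofReal_mul, hcross]
  ring

/-- The `(1,0)`-form `dw_l - 2i ᵗz̄ A_l dz`, whose imaginary part is the differential of the
defining function `Im w_l - ᵗz̄ A_l z`. -/
noncomputable def conormalForm (A : Fin d → Matrix (Fin n) (Fin n) ℂ) (l : Fin d)
    (z : Fin n → ℂ) : Ambient n d →ₗ[ℂ] ℂ where
  toFun v := v.2 l - 2 * I * (star z ⬝ᵥ A l *ᵥ v.1)
  map_add' v v' := by
    simp only [Prod.fst_add, Prod.snd_add, Pi.add_apply, Matrix.mulVec_add, dotProduct_add]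
    ring
  map_smul' c v := by
    simp only [Prod.smul_fst, Prod.smul_snd, Pi.smul_apply, Matrix.mulVec_smul, dotProduct_smul,
      smul_eq_mul, RingHom.id_apply]
    ring

lemma conormalForm_apply (l : Fin d) (z : Fin n → ℂ) (v : Ambient n d) :
    conormalForm A l z v = v.2 l - 2 * I * (star z ⬝ᵥ A l *ᵥ v.1) :=
  rfl

lemma conormalForm_im (l : Fin d) (z : Fin n → ℂ) (v : Ambient n d) :
    (conormalForm A l z v).im = (v.2 l).im - 2 * (star z ⬝ᵥ A l *ᵥ v.1).re := by
  simp [conormalForm_apply, mul_assoc]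

lemma defFun_add_smul (hA : ∀ l, (A l).IsHermitian) (l : Fin d) (p v : Ambient n d) (t : ℝ) :
    defFun A l (p + t • v)
      = defFun A l p + t * (conormalForm A l p.1 v).im - t ^ 2 * hermForm (A l) v.1 := by
  have hz : (p + t • v).1 = p.1 + (t : ℂ) • v.1 := rfl
  have hw : ((p + t • v).2 l).im = (p.2 l).im + t * (v.2 l).im := by simp
  rw [defFun, defFun, hz, hw, hermForm_add_smul (hA l), conormalForm_im]
  ring

lemma differentiable_defFun (l : Fin d) : Differentiable ℝ (defFun A l) := by
  have : defFun A l = fun p : Ambient n d => Complex.imCLM (p.2 l)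
      - Complex.reCLM (∑ i, Complex.conjCLE (p.1 i) * ∑ j, A l i j * p.1 j) := by
    ext p
    simp [defFun, hermForm, dotProduct, Matrix.mulVec]
  rw [this]
  fun_prop

lemma fderiv_defFun (hA : ∀ l, (A l).IsHermitian) (l : Fin d) (p v : Ambient n d) :
    fderiv ℝ (defFun A l) p v = (conormalForm A l p.1 v).im := by
  rw [← (differentiable_defFun l p).lineDeriv_eq_fderiv, lineDeriv]
  simp only [defFun_add_smul hA]
  have h := (((hasDerivAt_id (0 : ℝ)).mul_const (conormalForm A l p.1 v).im).const_add
    (defFun A l p)).sub ((hasDerivAt_pow 2 (0 : ℝ)).mul_const (hermForm (A l) v.1))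
  refine h.deriv.trans ?_
  simp

/-- The real part of the polynomial field `Y` is tangent to the quadric at each of its points. -/
def Tangent (A : Fin d → Matrix (Fin n) (Fin n) ℂ) (Y : PolyField n d) : Prop :=
  ∀ p ∈ quadric A, ∀ l, (conormalForm A l p.1 (toMap Y p)).im = 0

lemma analyticAt_toMap (Y : PolyField n d) (p : Ambient n d) : AnalyticAt ℂ (toMap Y) p := by
  have hcoord : ∀ i, AnalyticAt ℂ (fun p : Ambient n d => Sum.elim p.1 p.2 i) p := by
    rintro (j | l)
    · exact ((ContinuousLinearMap.proj j).comp (ContinuousLinearMap.fst ℂ _ _)).analyticAt p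
    · exact ((ContinuousLinearMap.proj l).comp (ContinuousLinearMap.snd ℂ _ _)).analyticAt p
  exact (AnalyticAt.pi fun j => .aeval_mvPolynomial hcoord _).prod
    (AnalyticAt.pi fun l => .aeval_mvPolynomial hcoord _)

@[fun_prop]
lemma differentiable_toMap (Y : PolyField n d) : Differentiable ℂ (toMap Y) :=
  fun p => (analyticAt_toMap Y p).differentiableAt

lemma smul_mem_quadric {p : Ambient n d} (hp : p ∈ quadric A) (t : ℝ) :
    ((t : ℂ) • p.1, (t : ℂ) ^ 2 • p.2) ∈ quadric A := by
  rw [mem_quadric_iff] at hp ⊢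
  intro l
  rw [hermForm_smul, ← hp l, Complex.norm_real, Real.norm_eq_abs, sq_abs, ← Complex.ofReal_pow]
  exact Complex.im_ofReal_mul _ _

lemma im_eq_zero_of_eventually {g : ℂ → ℂ} (hg : Differentiable ℂ g)
    (h : ∀ᶠ t : ℝ in 𝓝 0, (g t).im = 0) (t : ℝ) : (g t).im = 0 := by
  have hreal := eq_zero_of_eventually_ofReal_eq_zero (g := fun s => g s - conj (g (conj s)))
    (hg.sub fun s => differentiableAt_conj_conj_iff.mpr (hg _))
    (h.mono fun s hs => by
      rw [Complex.conj_ofReal, Complex.conj_eq_iff_im.mpr hs, sub_self]) t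
  rw [Complex.conj_ofReal, sub_eq_zero] at hreal
  exact Complex.conj_eq_iff_im.mp hreal.symm

lemma toMap_mem_aut_iff (hA : ∀ l, (A l).IsHermitian) {Y : PolyField n d} :
    toMap Y ∈ aut A ↔ Tangent A Y := by
  constructor
  · rintro ⟨-, hY⟩ p hp l
    let γ : ℂ → Ambient n d := fun t => (t • p.1, t ^ 2 • p.2)
    let g : ℂ → ℂ := fun t =>
      conormalForm A l p.1 (t • (toMap Y (γ t)).1, (toMap Y (γ t)).2)
    have hγ : Filter.Tendsto (fun t : ℝ => γ t) (𝓝 0) (𝓝[quadric A] 0) := by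
      refine tendsto_nhdsWithin_iff.mpr ⟨?_, .of_forall (smul_mem_quadric hp)⟩
      exact Continuous.tendsto' (by fun_prop) _ _ (by simp [γ])
    have hmap : Differentiable ℂ fun t => toMap Y (γ t) :=
      (differentiable_toMap Y).comp (by fun_prop)
    have hg : Differentiable ℂ g := (conormalForm A l p.1).toContinuousLinearMap.differentiable.comp
      ((differentiable_id.smul hmap.fst).prodMk hmap.snd)
    have hgγ : ∀ t : ℝ, conormalForm A l (γ t).1 (toMap Y (γ t)) = g t := fun t => by
      simp [g, γ, conormalForm_apply, Matrix.mulVec_smul]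
    have h1 := im_eq_zero_of_eventually hg (by
      filter_upwards [hγ.eventually hY] with t ht
      rw [← hgγ, ← fderiv_defFun hA, ht l]) 1
    have hγ1 : γ (1 : ℝ) = p := by simp [γ]
    rwa [← hgγ, hγ1] at h1
  · intro hY
    refine ⟨analyticAt_toMap Y 0, eventually_nhdsWithin_of_forall fun p hp l => ?_⟩
    rw [fderiv_defFun hA, hY p hp l]

end Tangency

section Brackets

variable {n d : ℕ} {A : Fin d → Matrix (Fin n) (Fin n) ℂ}

lemma bracket_W_apply_X (Y : PolyField n d) (l : Fin d) (c : Fin n ⊕ Fin d) :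
    ⁅Y, W l⁆ (X c) = -pderiv (Sum.inr l) (Y (X c)) := by
  classical
  have h : Y ((W l : PolyField n d) (X c)) = 0 := by
    rw [W, pderiv_X]
    obtain rfl | hc := eq_or_ne (Sum.inr l) c
    · simp
    · simp [hc.symm]
  rw [Derivation.commutator_apply, h, zero_sub, W]

lemma HasWeight.bracket_W {ν : ℚ} {Y : PolyField n d} (hY : HasWeight (ν + 1) Y) (l : Fin d) :
    HasWeight ν ⁅Y, (W l : PolyField n d)⁆ := by
  refine ⟨fun j => ?_, fun m => ?_⟩ <;>
    rw [bracket_W_apply_X, ← mem_weightedHomogeneousSubmodule]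
  · refine neg_mem ((hY.1 j).pderiv ?_)
    simp only [wt, Sum.elim_inr]
    ring
  · refine neg_mem ((hY.2 m).pderiv ?_)
    simp only [wt, Sum.elim_inr]

lemma hasDerivAt_toMap (Y : PolyField n d) (p : Ambient n d) (m : Fin d) :
    HasDerivAt (fun t : ℂ => toMap Y (p.1, p.2 + t • Pi.single m 1)) (-toMap ⁅Y, W m⁆ p) 0 := by
  have hcoord : ∀ c, HasDerivAt
      (fun t : ℂ => eval (Sum.elim p.1 (p.2 + t • Pi.single m 1)) (Y (X c)))
      (-eval (Sum.elim p.1 p.2) (⁅Y, W m⁆ (X c))) 0 := fun c => by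
    convert hasDerivAt_eval_add_smul (Y (X c)) (Sum.elim p.1 p.2) (Sum.elim 0 (Pi.single m 1))
      using 1
    · ext t
      congr 2
      ext (j | l) <;> simp [Pi.single_apply]
    · simp [bracket_W_apply_X, Pi.single_apply]
  exact (hasDerivAt_pi.mpr fun j => hcoord (Sum.inl j)).prodMk
    (hasDerivAt_pi.mpr fun l => hcoord (Sum.inr l))

lemma im_eq_zero_of_hasDerivAt {g : ℂ → ℂ} {g' : ℂ} (hg : HasDerivAt g g' 0)
    (h : ∀ t : ℝ, (g t).im = 0) : g'.im = 0 := by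
  have him := Complex.imCLM.hasFDerivAt.comp_hasDerivAt (0 : ℝ)
    (HasDerivAt.comp_ofReal (z := 0) (by simpa using hg))
  have hconst : Complex.imCLM ∘ (fun t : ℝ => g t) = fun _ => 0 := funext h
  rw [hconst] at him
  exact him.unique (hasDerivAt_const 0 0)

lemma Tangent.bracket_W {Y : PolyField n d} (hY : Tangent A Y) (m : Fin d) :
    Tangent A ⁅Y, W m⁆ := by
  intro p hp l
  have htranslate : ∀ t : ℝ, (p.1, p.2 + (t : ℂ) • Pi.single m 1) ∈ quadric A := fun t => by
    rw [mem_quadric_iff] at hp ⊢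
    intro k
    obtain rfl | hk := eq_or_ne k m <;> simp [*]
  have hderiv := ((conormalForm A l p.1).toContinuousLinearMap.hasFDerivAt.comp_hasDerivAt 0
    (hasDerivAt_toMap Y p m))
  have him := im_eq_zero_of_hasDerivAt hderiv fun t => hY _ (htranslate t) l
  simpa using him

lemma multiBracket_induction {P : ℚ → PolyField n d → Prop}
    (hP : ∀ ν Z l, P (ν + 1) Z → P ν ⁅Z, W l⁆) {μ : ℚ} {k : Fin d → ℕ} {Y : PolyField n d}
    (hY : P (μ + ((∑ l, k l : ℕ) : ℚ)) Y) : P μ (multiBracket k Y) := by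
  have hbracket : ∀ l m ν Z, P (ν + (m : ℕ)) Z → P ν (bracketW l m Z) := by
    intro l m
    induction m with
    | zero => intro ν Z hZ; simpa [bracketW] using hZ
    | succ m ih =>
      intro ν Z hZ
      exact ih ν _ (hP _ _ _ (by rwa [add_assoc, ← Nat.cast_succ]))
  have hlist : ∀ (L : List (Fin d)) ν, P (ν + ((L.map k).sum : ℕ)) Y →
      P ν (L.foldr (fun l Z => bracketW l (k l) Z) Y) := by
    intro L
    induction L with
    | nil => intro ν h; simpa using h
    | cons l L ih =>
      intro ν h
      refine hbracket _ _ _ _ (ih _ ?_)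
      simpa [add_assoc] using h
  exact hlist _ μ (by rwa [← Fin.sum_univ_def])

lemma multiBracket_mem_G (hA : ∀ l, (A l).IsHermitian) {μ : ℚ} {k : Fin d → ℕ}
    {Y : PolyField n d} (hY : Y ∈ G A (μ + ((∑ l, k l : ℕ) : ℚ))) : multiBracket k Y ∈ G A μ :=
  multiBracket_induction (P := fun ν Z => Z ∈ G A ν)
    (fun _ _ l hZ => ⟨HasWeight.bracket_W hZ.1 l, (toMap_mem_aut_iff hA).mpr
      (((toMap_mem_aut_iff hA).mp hZ.2).bracket_W l)⟩) hY

lemma HasWeight.apply_X_inl_eq_zero {Y : PolyField n d} (hY : HasWeight (-1) Y) (j : Fin n) :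
    Y (X (Sum.inl j)) = 0 :=
  eq_zero_of_weight_neg (hY.1 j) (by norm_num)

lemma HasWeight.isRigid {Y : PolyField n d} (hY : HasWeight (-1) Y) : IsRigid Y := by
  rintro (j | m) l
  · simp [hY.apply_X_inl_eq_zero]
  · have h0 : IsWeightedHomogeneous (wt n d) (Y (X (Sum.inr m))) 0 := by simpa using hY.2 m
    rw [eq_C_of_weight_zero h0, vars_C]
    simp

lemma mem_integrations_neg_one (hA : ∀ l, (A l).IsHermitian) {k : Fin d → ℕ} {m : ℕ}
    {Y : PolyField n d} (hk : ∑ l, k l = m) (hY : Y ∈ G A (-1 + m)) (hne : multiBracket k Y ≠ 0) :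
    Y ∈ integrations A m (-1) := by
  subst hk
  have hmem := multiBracket_mem_G hA hY
  exact ⟨k, _, rfl, ⟨hmem, hmem.1.isRigid⟩, hY, rfl, fun h => absurd h hne⟩

lemma derivation_eq_zero {Y : PolyField n d} (hz : ∀ j, Y (X (Sum.inl j)) = 0)
    (hw : ∀ l, Y (X (Sum.inr l)) = 0) : Y = 0 :=
  derivation_ext (Sum.rec hz hw)

end Brackets

section Parts

open Complex (I)

open scoped ComplexConjugate

variable {n d : ℕ} {A : Fin d → Matrix (Fin n) (Fin n) ℂ} {Y : PolyField n d}

/-- The part of the `∂/∂z`-coefficients that is homogeneous of degree `k` in the variables `z`. -/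
noncomputable def zPart (Y : PolyField n d) (k : ℕ) (z : Fin n → ℂ) (w : Fin d → ℂ) : Fin n → ℂ :=
  fun j => (slice (Y (X (Sum.inl j))) z w).coeff k

/-- The part of the `∂/∂w`-coefficients that is homogeneous of degree `k` in the variables `z`. -/
noncomputable def wPart (Y : PolyField n d) (k : ℕ) (z : Fin n → ℂ) (w : Fin d → ℂ) : Fin d → ℂ :=
  fun l => (slice (Y (X (Sum.inr l))) z w).coeff k

lemma zPart_zero (Y : PolyField n d) (z : Fin n → ℂ) (w : Fin d → ℂ) :
    zPart Y 0 z w = (toMap Y (0, w)).1 :=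
  funext fun _ => slice_coeff_zero ..

lemma wPart_zero (Y : PolyField n d) (z : Fin n → ℂ) (w : Fin d → ℂ) :
    wPart Y 0 z w = (toMap Y (0, w)).2 :=
  funext fun _ => slice_coeff_zero ..

lemma zPart_smul {m k : ℕ} {μ : ℚ} (hY : HasWeight μ Y) (h : μ + 1 / 2 = m + k / 2)
    (z : Fin n → ℂ) (w : Fin d → ℂ) (c : ℂ) : zPart Y k z (c • w) = c ^ m • zPart Y k z w :=
  funext fun j => slice_coeff_smul (h ▸ hY.1 j) z w c

lemma wPart_smul {m k : ℕ} {μ : ℚ} (hY : HasWeight μ Y) (h : μ + 1 = m + k / 2)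
    (z : Fin n → ℂ) (w : Fin d → ℂ) (c : ℂ) : wPart Y k z (c • w) = c ^ m • wPart Y k z w :=
  funext fun l => slice_coeff_smul (h ▸ hY.2 l) z w c

/-- The quadric contains the circle `(t z, w)`, `‖t‖ = 1`, through each of its points `(z, w)`. -/
lemma Tangent.parts_eq (hY : Tangent A Y) {z : Fin n → ℂ} {w : Fin d → ℂ}
    (hzw : (z, w) ∈ quadric A) (l : Fin d) :
    (wPart Y 0 z w l).im = 2 * (star z ⬝ᵥ A l *ᵥ zPart Y 1 z w).re ∧
    wPart Y 1 z w l = 2 * I * (star z ⬝ᵥ A l *ᵥ zPart Y 2 z w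
      + conj (star z ⬝ᵥ A l *ᵥ zPart Y 0 z w)) := by
  let Q : Polynomial ℂ := ∑ i, Polynomial.C ((star z ᵥ* A l) i) * slice (Y (X (Sum.inl i))) z w
  have hcoeff : ∀ k, Q.coeff k = star z ⬝ᵥ A l *ᵥ zPart Y k z w := fun k => by
    rw [Matrix.dotProduct_mulVec]
    simp [Q, Polynomial.finsetSum_coeff, dotProduct, zPart]
  have heval : ∀ t, Q.eval t = star z ⬝ᵥ A l *ᵥ (toMap Y (t • z, w)).1 := fun t => by
    rw [Matrix.dotProduct_mulVec]
    simp [Q, Polynomial.eval_finsetSum, dotProduct, eval_slice, toMap]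
  simp only [← hcoeff]
  refine coeff_eq_of_im_eval_eq fun t ht => ?_
  have hmem : (t • z, w) ∈ quadric A := by
    rw [mem_quadric_iff] at hzw ⊢
    simpa [hermForm_smul, ht] using hzw
  have htangent := hY _ hmem l
  rw [conormalForm_im, sub_eq_zero, star_smul, smul_dotProduct] at htangent
  rw [heval, eval_slice]
  exact htangent

lemma smul_polarForm_mem_quadric (hA : ∀ l, (A l).IsHermitian) (z : Fin n → ℂ) (s : ℝ) :
    (z, ((s : ℂ) + I) • polarForm A (star z) z) ∈ quadric A := by
  simp [mem_quadric_iff, polarForm_star hA]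

lemma Tangent.im_toMap_ofReal (hY : Tangent A Y) (u : Fin d → ℝ) (l : Fin d) :
    ((toMap Y (0, fun l => (u l : ℂ))).2 l).im = 0 := by
  have hmem : ((0, fun l => (u l : ℂ)) : Ambient n d) ∈ quadric A := by
    simp [mem_quadric_iff, hermForm]
  simpa [conormalForm_im] using hY _ hmem l

lemma eq_zero_of_im_eq_two_mul_re {g h : ℂ} (hh : h.im = 0)
    (hgh : ∀ s : ℝ, (((s : ℂ) + I) ^ 3 * h).im = 2 * (((s : ℂ) + I) ^ 2 * g).re) : h = 0 := by
  have hpos : (1 + 1) * h.re = -(2 * ((1 + 1) * g.im)) := by simpa [pow_succ, hh] using hgh 1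
  have hneg : (1 + 1) * h.re = -(2 * ((-1 + -1) * g.im)) := by simpa [pow_succ, hh] using hgh (-1)
  exact Complex.ext (by simp only [Complex.zero_re]; linarith) hh

lemma eq_zero_of_eq_add_conj {f g h : ℂ}
    (hfgh : ∀ s : ℝ, ((s : ℂ) + I) ^ 2 * h
      = 2 * I * (((s : ℂ) + I) * f + conj (((s : ℂ) + I) ^ 2 * g))) : g = 0 := by
  have hzero := hfgh 0
  have hpos := hfgh 1
  have hneg := hfgh (-1)
  simp only [map_mul, map_pow, map_add, map_neg, map_one, map_zero, Complex.conj_I,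
    Complex.ofReal_zero, Complex.ofReal_one, Complex.ofReal_neg] at hzero hpos hneg
  obtain rfl : f = 0 := by
    have : 2 * I * (2 * I) * f = 0 := by
      linear_combination -hpos - hneg + 2 * (h - 2 * I * conj g) * Complex.I_sq
    simpa using this
  have hh : h = 2 * I * conj g := by
    linear_combination -hzero + (h - 2 * I * conj g) * Complex.I_sq
  have hg : 8 * conj g = 0 := by
    rw [hh] at hpos
    linear_combination -hpos + 8 * conj g * Complex.I_sq
  simpa using hg

lemma wPart_zero_eq_zero (hA : ∀ l, (A l).IsHermitian) (hgen : GenericallyIndependent A)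
    (hY : Tangent A Y) (hweight : HasWeight 2 Y) (w : Fin d → ℂ) : (toMap Y (0, w)).2 = 0 := by
  refine hgen.eq_zero_of_polarForm (g := fun w => (toMap Y (0, w)).2)
    (((differentiable_toMap Y).comp (by fun_prop)).snd) (fun z => funext fun l => ?_) w
  rw [← wPart_zero Y z]
  refine eq_zero_of_im_eq_two_mul_re
    (g := star z ⬝ᵥ A l *ᵥ zPart Y 1 z (polarForm A (star z) z)) ?_ fun s => ?_
  · rw [wPart_zero, polarForm_star hA]
    exact hY.im_toMap_ofReal _ l
  · have h := (hY.parts_eq (smul_polarForm_mem_quadric hA z s) l).1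
    rwa [wPart_smul (m := 3) hweight (by norm_num), zPart_smul (m := 2) hweight (by norm_num),
      Matrix.mulVec_smul, dotProduct_smul] at h

lemma zPart_zero_eq_zero (hA : ∀ l, (A l).IsHermitian) (hgen : GenericallyIndependent A)
    (hker : ∀ z, (∀ l, A l *ᵥ z = 0) → z = 0)
    (hY : Tangent A Y) (hweight : HasWeight (3 / 2) Y) (w : Fin d → ℂ) :
    (toMap Y (0, w)).1 = 0 := by
  refine hgen.eq_zero_of_polarForm_apply hker (f := fun w => (toMap Y (0, w)).1)
    (((differentiable_toMap Y).comp (by fun_prop)).fst) (fun z => funext fun l => ?_) w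
  rw [← zPart_zero Y z]
  refine eq_zero_of_eq_add_conj (f := star z ⬝ᵥ A l *ᵥ zPart Y 2 z (polarForm A (star z) z))
    (h := wPart Y 1 z (polarForm A (star z) z) l) fun s => ?_
  have h := (hY.parts_eq (smul_polarForm_mem_quadric hA z s) l).2
  rwa [wPart_smul (m := 2) hweight (by norm_num), zPart_smul (m := 1) hweight (by norm_num),
    zPart_smul (m := 2) hweight (by norm_num), Matrix.mulVec_smul, dotProduct_smul,
    Matrix.mulVec_smul, dotProduct_smul, pow_one] at h

end Parts

section Uniqueness

open Complex (I)

variable {n d : ℕ} {A : Fin d → Matrix (Fin n) (Fin n) ℂ}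

lemma IsRigid.toMap_eq {Y : PolyField n d} (hY : IsRigid Y) (z : Fin n → ℂ) (w w' : Fin d → ℂ) :
    toMap Y (z, w) = toMap Y (z, w') := by
  have heval : ∀ c, eval (Sum.elim z w) (Y (X c)) = eval (Sum.elim z w') (Y (X c)) := fun c => by
    refine eval₂Hom_congr' rfl ?_ rfl
    rintro (j | l) hc _
    · rfl
    · exact absurd hc (hY c l)
  exact Prod.ext (funext fun j => heval _) (funext fun l => heval _)

lemma eq_zero_of_isRigid (hA : ∀ l, (A l).IsHermitian) {Y : PolyField n d} {μ : ℚ} (hY : Y ∈ GR A μ)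
    (hμ : μ + 1 ≠ 0) (hz : ∀ j, Y (X (Sum.inl j)) = 0) : Y = 0 := by
  have htangent := (toMap_mem_aut_iff hA).mp hY.1.2
  refine derivation_eq_zero hz fun l => MvPolynomial.funext fun x => ?_
  obtain ⟨z, w, rfl⟩ : ∃ z w, Sum.elim z w = x := ⟨_, _, Sum.elim_comp_inl_inr x⟩
  have him : ∀ t : ℂ, ‖t‖ = 1 →
      ((Polynomial.C I * slice (Y (X (Sum.inr l))) z 0).eval t).re = 0 := fun t _ => by
    have hmem : (t • z, fun l => I * (hermForm (A l) (t • z) : ℂ)) ∈ quadric A := by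
      simp [mem_quadric_iff]
    have h := htangent _ hmem l
    rw [hY.2.toMap_eq _ _ 0, conormalForm_im] at h
    simpa [toMap, hz, eval_slice, ← Pi.zero_def] using h
  obtain ⟨c, -, hc⟩ := exists_eq_C_of_re_eq_zero him
  have hconst : ∀ t, I * eval (Sum.elim (t • z) 0) (Y (X (Sum.inr l))) = c := fun t => by
    rw [← eval_slice, ← Polynomial.eval_C_mul, hc, Polynomial.eval_C]
  have h0 := eval_zero_of_weight_ne_zero (hY.1.1.2 l) hμ
  have h1 := (hconst 1).trans (hconst 0).symm
  have hrigid := congrFun (congrArg Prod.snd (hY.2.toMap_eq z w 0)) l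
  simp only [toMap] at hrigid
  rw [eval_zero] at h0
  simpa [hrigid, h0] using h1

lemma map_toMap_bracket_W_eq_zero {F : Type*} [NormedAddCommGroup F] [NormedSpace ℂ F]
    (L : Ambient n d →L[ℂ] F) {Y : PolyField n d} {z : Fin n → ℂ}
    (h : ∀ w, L (toMap Y (z, w)) = 0) (m : Fin d) (w : Fin d → ℂ) :
    L (toMap ⁅Y, (W m : PolyField n d)⁆ (z, w)) = 0 := by
  have hderiv := L.hasFDerivAt.comp_hasDerivAt 0 (hasDerivAt_toMap Y (z, w) m)
  have hconst : (L ∘ fun t : ℂ => toMap Y (z, w + t • Pi.single m 1)) = fun _ => 0 :=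
    funext fun _ => h _
  rw [hconst] at hderiv
  simpa using hderiv.unique (hasDerivAt_const 0 0)

lemma map_toMap_multiBracket_eq_zero {F : Type*} [NormedAddCommGroup F] [NormedSpace ℂ F]
    (L : Ambient n d →L[ℂ] F) {Y : PolyField n d} {z : Fin n → ℂ}
    (h : ∀ w, L (toMap Y (z, w)) = 0) (k : Fin d → ℕ) (w : Fin d → ℂ) :
    L (toMap (multiBracket k Y) (z, w)) = 0 :=
  multiBracket_induction (P := fun _ Z => ∀ w, L (toMap Z (z, w)) = 0) (μ := 0)
    (fun _ _ m hZ => map_toMap_bracket_W_eq_zero L hZ m) h w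

lemma zero_mem_G (hA : ∀ l, (A l).IsHermitian) (μ : ℚ) : 0 ∈ G A μ :=
  ⟨⟨fun _ => isWeightedHomogeneous_zero .., fun _ => isWeightedHomogeneous_zero ..⟩,
    (toMap_mem_aut_iff hA).mpr fun p _ l => by
      simp [conormalForm_im, toMap, ← Pi.zero_def]⟩

lemma multiBracket_zero (k : Fin d → ℕ) : multiBracket k (0 : PolyField n d) = 0 :=
  multiBracket_induction (P := fun _ Z => Z = 0) (μ := 0)
    (by rintro _ _ l rfl; exact zero_lie (W l)) rfl

lemma zero_mem_integrations [NeZero d] (hA : ∀ l, (A l).IsHermitian) (m : ℕ) (μ : ℚ) :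
    0 ∈ integrations A m μ :=
  ⟨Pi.single 0 m, 0, by simp, ⟨zero_mem_G hA μ, by simp [IsRigid]⟩, zero_mem_G hA _,
    multiBracket_zero _, fun _ => rfl⟩

theorem integrations_three_neg_one [NeZero d] (hA : ∀ l, (A l).IsHermitian)
    (hgen : GenericallyIndependent A) : integrations A 3 (-1) = {0} := by
  refine Set.Subset.antisymm ?_ (Set.singleton_subset_iff.mpr (zero_mem_integrations hA 3 _))
  rintro Y ⟨k, X', hk, hX, hY, rfl, hzero⟩
  refine hzero (derivation_eq_zero hX.1.1.apply_X_inl_eq_zero fun l => ?_)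
  rw [hk, show (-1 + ((3 : ℕ) : ℚ)) = 2 by norm_num] at hY
  have hpart := map_toMap_multiBracket_eq_zero (ContinuousLinearMap.snd ℂ _ _)
    (wPart_zero_eq_zero hA hgen ((toMap_mem_aut_iff hA).mp hY.2) hY.1) k 0
  have h0 : eval 0 (multiBracket k Y (X (Sum.inr l))) = 0 := by
    simpa [toMap] using congrFun hpart l
  have hconst : IsWeightedHomogeneous (wt n d) (multiBracket k Y (X (Sum.inr l))) 0 := by
    simpa using hX.1.1.2 l
  rw [eq_C_of_weight_zero hconst, h0, C_0]

theorem integrations_two_neg_half [NeZero d] (hA : ∀ l, (A l).IsHermitian)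
    (hgen : GenericallyIndependent A) (hker : ∀ z, (∀ l, A l *ᵥ z = 0) → z = 0) :
    integrations A 2 (-1 / 2) = {0} := by
  refine Set.Subset.antisymm ?_ (Set.singleton_subset_iff.mpr (zero_mem_integrations hA 2 _))
  rintro Y ⟨k, X', hk, hX, hY, rfl, hzero⟩
  refine hzero (eq_zero_of_isRigid hA hX (by norm_num) fun j => ?_)
  rw [hk, show (-1 / 2 + ((2 : ℕ) : ℚ)) = 3 / 2 by norm_num] at hY
  have hpart := map_toMap_multiBracket_eq_zero (ContinuousLinearMap.fst ℂ _ _)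
    (zPart_zero_eq_zero hA hgen hker ((toMap_mem_aut_iff hA).mp hY.2) hY.1) k 0
  have h0 : eval 0 (multiBracket k Y (X (Sum.inl j))) = 0 := by
    simpa [toMap] using congrFun hpart j
  have hconst : IsWeightedHomogeneous (wt n d) (multiBracket k Y (X (Sum.inl j))) 0 := by
    convert hX.1.1.1 j using 1
    norm_num
  rw [eq_C_of_weight_zero hconst, h0, C_0]

end Uniqueness

section SecondBrackets

open Complex (I)

variable {n d : ℕ}

lemma eval_eq_zero_of_pderiv_pderiv_eq_zero {f : Poly n d} {μ : ℚ}
    (hf : IsWeightedHomogeneous (wt n d) f μ) (hμ : μ ≠ 0) (hμ' : μ - 1 ≠ 0)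
    (h : ∀ i j, pderiv (Sum.inr i) (pderiv (Sum.inr j) f) = 0) (w : Fin d → ℂ) :
    eval (Sum.elim 0 w) f = 0 := by
  have hderiv : ∀ j, eval (Sum.elim 0 w) (pderiv (Sum.inr j) f) = 0 := fun j => by
    have heuler := mul_eval_eq_sum_pderiv
      (hf.pderiv (i := Sum.inr j) (n' := μ - 1) (by simp [wt])) 0 w
    simpa [h, -Rat.cast_sub, hμ'] using heuler
  simpa [hderiv, hμ] using mul_eval_eq_sum_pderiv hf 0 w

lemma eq_zero_of_pderiv_eq_zero {f : Poly n d} {μ : ℚ}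
    (hf : IsWeightedHomogeneous (wt n d) f μ) (hμ : μ ≠ 0) (h : ∀ c, pderiv c f = 0) : f = 0 := by
  refine MvPolynomial.funext fun x => ?_
  have heuler := mul_eval_eq_sum_pderiv hf (x ∘ Sum.inl) (x ∘ Sum.inr)
  simpa [h, hμ, Sum.elim_comp_inl_inr] using heuler

lemma HasWeight.snd_toMap_eq_zero {Y : PolyField n d} (hY : HasWeight 1 Y)
    (h : ∀ c i j, pderiv (Sum.inr i) (pderiv (Sum.inr j) (Y (X c))) = 0) (w : Fin d → ℂ) :
    (toMap Y (0, w)).2 = 0 := by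
  funext l
  simpa only [toMap, Pi.zero_apply] using
    eval_eq_zero_of_pderiv_pderiv_eq_zero (hY.2 l) (by norm_num) (by norm_num) (h _) w

lemma multiBracket_two (k : Fin 2 → ℕ) (Y : PolyField n 2) :
    multiBracket k Y = bracketW 0 (k 0) (bracketW 1 (k 1) Y) :=
  rfl

lemma pderiv_pderiv_eq_zero {Y : PolyField n 2}
    (h : ∀ k : Fin 2 → ℕ, ∑ l, k l = 2 → multiBracket k Y = 0) (c : Fin n ⊕ Fin 2) (i j : Fin 2) :
    pderiv (Sum.inr i) (pderiv (Sum.inr j) (Y (X c))) = 0 := by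
  have h00 := DFunLike.congr_fun (h ![2, 0] (by simp)) (X c)
  have h01 := DFunLike.congr_fun (h ![1, 1] (by simp)) (X c)
  have h11 := DFunLike.congr_fun (h ![0, 2] (by simp)) (X c)
  simp only [multiBracket_two, bracketW, Matrix.cons_val_zero, Matrix.cons_val_one,
    Function.iterate_succ, Function.iterate_zero, Function.comp_apply, id_eq, bracket_W_apply_X,
    map_neg, neg_neg, Derivation.zero_apply] at h00 h01 h11
  fin_cases i <;> fin_cases j
  · exact h00
  · exact h01
  · exact (pderiv_comm _ _ _).trans h01
  · exact h11

/-- The matrices `B_l` such that `∑ w_l B_l z` is the part of the `∂/∂z`-coefficients that is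
linear in `z` and in `w`. -/
noncomputable def linearPart (Y : PolyField n d) (l : Fin d) : Matrix (Fin n) (Fin n) ℂ :=
  Matrix.of fun j i => eval 0 (pderiv (Sum.inr l) (pderiv (Sum.inl i) (Y (X (Sum.inl j)))))

lemma zPart_one_eq {Y : PolyField n d} (hY : HasWeight 1 Y) (z : Fin n → ℂ) (w : Fin d → ℂ) :
    zPart Y 1 z w = ∑ l, w l • (linearPart Y l *ᵥ z) := by
  ext j
  have hcoeff : ∀ i, eval (Sum.elim 0 w) (pderiv (Sum.inl i) (Y (X (Sum.inl j))))
      = ∑ l, w l * linearPart Y l j i := fun i => by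
    have hderiv : IsWeightedHomogeneous (wt n d) (pderiv (Sum.inl i) (Y (X (Sum.inl j)))) 1 :=
      (hY.1 j).pderiv (by simp [wt])
    have heuler := mul_eval_eq_sum_pderiv hderiv 0 w
    simp only [Rat.cast_one, one_mul, Pi.zero_apply, zero_mul, Finset.sum_const_zero, mul_zero,
      zero_add] at heuler
    rw [heuler]
    refine Finset.sum_congr rfl fun l _ => ?_
    have hconst : IsWeightedHomogeneous (wt n d)
        (pderiv (Sum.inr l) (pderiv (Sum.inl i) (Y (X (Sum.inl j))))) 0 :=
      hderiv.pderiv (by simp [wt])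
    rw [eq_C_of_weight_zero hconst, eval_C, linearPart, Matrix.of_apply]
  simp only [zPart, slice_coeff_one, hcoeff, Finset.sum_apply, Pi.smul_apply, smul_eq_mul,
    Matrix.mulVec, dotProduct, Finset.mul_sum]
  rw [Finset.sum_comm]
  exact Finset.sum_congr rfl fun _ _ => Finset.sum_congr rfl fun _ _ => by ring

lemma Tangent.re_sum_linearPart_eq_zero {A : Fin d → Matrix (Fin n) (Fin n) ℂ} {Y : PolyField n d}
    (hY : Tangent A Y) (hweight : HasWeight 1 Y) (hwPart : ∀ w, (toMap Y (0, w)).2 = 0)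
    (z : Fin n → ℂ) (u : Fin d → ℝ) (l : Fin d) :
    (∑ k, ((u k : ℂ) + I * hermForm (A k) z)
      * (star z ⬝ᵥ (A l * linearPart Y k) *ᵥ z)).re = 0 := by
  have hmem : (z, fun k => (u k : ℂ) + I * hermForm (A k) z) ∈ quadric A := by
    simp [mem_quadric_iff]
  have h := (hY.parts_eq hmem l).1
  rw [wPart_zero, hwPart, zPart_one_eq hweight, Matrix.mulVec_sum, dotProduct_sum] at h
  simpa [Matrix.mulVec_smul, dotProduct_smul, Matrix.mulVec_mulVec] using h

lemma Tangent.re_linearPart_eq_zero {A : Fin d → Matrix (Fin n) (Fin n) ℂ}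
    {Y : PolyField n d} (hY : Tangent A Y) (hweight : HasWeight 1 Y)
    (hwPart : ∀ w, (toMap Y (0, w)).2 = 0) (k l : Fin d)
    (z : Fin n → ℂ) : (star z ⬝ᵥ (A l * linearPart Y k) *ᵥ z).re = 0 := by
  have h0 := hY.re_sum_linearPart_eq_zero hweight hwPart z 0 l
  have h1 := hY.re_sum_linearPart_eq_zero hweight hwPart z (Pi.single k 1) l
  simp only [add_mul, Finset.sum_add_distrib, Complex.add_re, Pi.zero_apply, Complex.ofReal_zero,
    zero_add] at h0 h1
  rw [h0, add_zero, Finset.sum_eq_single k (fun b _ hb => by simp [hb]) (by simp)] at h1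
  simpa using h1

lemma Tangent.sum_polarForm_mul_linearPart {A : Fin d → Matrix (Fin n) (Fin n) ℂ}
    (hA : ∀ l, (A l).IsHermitian) {Y : PolyField n d} (hY : Tangent A Y) (hweight : HasWeight 1 Y)
    (hwPart : ∀ w, (toMap Y (0, w)).2 = 0) (l : Fin d) (ζ z : Fin n → ℂ) :
    ∑ k, (ζ ⬝ᵥ A k *ᵥ z) * (ζ ⬝ᵥ (A l * linearPart Y k) *ᵥ z) = 0 := by
  refine eq_zero_of_apply_star_eq_zero
    (f := fun ζ z => ∑ k, (ζ ⬝ᵥ A k *ᵥ z) * (ζ ⬝ᵥ (A l * linearPart Y k) *ᵥ z))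
    (by fun_prop) (fun z => ?_) ζ z
  have him := hY.re_sum_linearPart_eq_zero hweight hwPart z 0 l
  simp only [Pi.zero_apply, Complex.ofReal_zero, zero_add, mul_assoc, ← Finset.mul_sum,
    Complex.I_mul_re, neg_eq_zero] at him
  simp only [← ofReal_hermForm (hA _)]
  refine Complex.ext ?_ him
  simp [hY.re_linearPart_eq_zero hweight hwPart]

lemma linearPart_eq_zero {A : Fin 2 → Matrix (Fin n) (Fin n) ℂ} (hA : Nondegenerate A)
    {Y : PolyField n 2} (hY : Tangent A Y) (hweight : HasWeight 1 Y)
    (hwPart : ∀ w, (toMap Y (0, w)).2 = 0) (k : Fin 2) : linearPart Y k = 0 :=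
  eq_zero_of_mul_skew hA
    (fun l => conjTranspose_eq_neg_of_re_eq_zero (hY.re_linearPart_eq_zero hweight hwPart 0 l))
    (hY.sum_polarForm_mul_linearPart hA.isHermitian hweight hwPart) k

end SecondBrackets

section EulerField

variable {n d : ℕ}

lemma exists_multiBracket_ne_zero {A : Fin 2 → Matrix (Fin n) (Fin n) ℂ} (hA : Nondegenerate A)
    {Y : PolyField n 2} {l : Fin 2} (hY : Y ∈ G A 1) (hrigid : IsRigid ⁅Y, (W l : PolyField n 2)⁆)
    (hne : ⁅Y, (W l : PolyField n 2)⁆ ≠ 0) :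
    ∃ k : Fin 2 → ℕ, ∑ l, k l = 2 ∧ multiBracket k Y ≠ 0 := by
  by_contra! h
  have htangent := (toMap_mem_aut_iff hA.isHermitian).mp hY.2
  have hwPart : ∀ w, (toMap Y (0, w)).2 = 0 :=
    hY.1.snd_toMap_eq_zero (pderiv_pderiv_eq_zero h)
  have hweight : HasWeight 0 ⁅Y, (W l : PolyField n 2)⁆ :=
    HasWeight.bracket_W (by simpa using hY.1) l
  have hmem : ⁅Y, (W l : PolyField n 2)⁆ ∈ GR A 0 :=
    ⟨⟨hweight, (toMap_mem_aut_iff hA.isHermitian).mpr (htangent.bracket_W l)⟩, hrigid⟩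
  refine hne (eq_zero_of_isRigid hA.isHermitian hmem (by norm_num) fun j =>
    eq_zero_of_pderiv_eq_zero (hweight.1 j) (by norm_num) ?_)
  rintro (i | m)
  · have hconst : IsWeightedHomogeneous (wt n 2)
        (pderiv (Sum.inl i) (⁅Y, (W l : PolyField n 2)⁆ (X (Sum.inl j)))) 0 :=
      (hweight.1 j).pderiv (by simp [wt])
    have hentry := congrFun₂ (linearPart_eq_zero hA htangent hY.1 hwPart l) j i
    rw [eq_C_of_weight_zero hconst, bracket_W_apply_X, map_neg, pderiv_comm, map_neg]
    rw [linearPart, Matrix.of_apply, Matrix.zero_apply] at hentry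
    rw [hentry, neg_zero, C_0]
  · exact pderiv_eq_zero_of_notMem_vars (hrigid _ m)

theorem integrations_one_zero_subset {A : Fin 2 → Matrix (Fin n) (Fin n) ℂ}
    (hA : Nondegenerate A) : integrations A 1 0 \ {0} ⊆ integrations A 2 (-1) := by
  rintro Y ⟨⟨k, X', hk, ⟨hX, hY, rfl, hzero⟩⟩, hY0⟩
  have hne : multiBracket k Y ≠ 0 := fun h => hY0 (hzero h)
  obtain ⟨l, hl⟩ : ∃ l, multiBracket k Y = ⁅Y, (W l : PolyField n 2)⁆ := by
    rw [Fin.sum_univ_two] at hk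
    obtain ⟨h0, h1⟩ | ⟨h0, h1⟩ : k 0 = 1 ∧ k 1 = 0 ∨ k 0 = 0 ∧ k 1 = 1 := by omega
    · exact ⟨0, by rw [multiBracket_two, h0, h1]; rfl⟩
    · exact ⟨1, by rw [multiBracket_two, h0, h1]; rfl⟩
  rw [hl] at hX hne
  rw [hk, Nat.cast_one, zero_add] at hY
  obtain ⟨k', hk', hne'⟩ := exists_multiBracket_ne_zero hA hY hX.2 hne
  exact mem_integrations_neg_one hA.isHermitian hk' (by norm_num [hY]) hne'

/-- The Euler field `½ ∑ z_j ∂/∂z_j + ∑ w_l ∂/∂w_l`, which generates the dilations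
`(z, w) ↦ (t z, t² w)` of the quadric. -/
noncomputable def eulerField (n d : ℕ) : PolyField n d :=
  mkDerivation ℂ (Sum.elim (fun j => C (1 / 2) * X (Sum.inl j)) (fun l => X (Sum.inr l)))

lemma toMap_eulerField (p : Ambient n d) : toMap (eulerField n d) p = ((1 / 2 : ℂ) • p.1, p.2) :=
  Prod.ext (funext fun j => by simp [toMap, eulerField])
    (funext fun l => by simp [toMap, eulerField])

lemma eulerField_mem_G {A : Fin d → Matrix (Fin n) (Fin n) ℂ} (hA : ∀ l, (A l).IsHermitian) :
    eulerField n d ∈ G A 0 := by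
  refine ⟨⟨fun j => ?_, fun l => ?_⟩, (toMap_mem_aut_iff hA).mpr fun p hp l => ?_⟩
  · rw [eulerField, mkDerivation_X]
    exact (isWeightedHomogeneous_C (wt n d) (1 / 2 : ℂ)).mul
      (isWeightedHomogeneous_X ℂ (wt n d) (Sum.inl j))
  · rw [eulerField, mkDerivation_X, zero_add]
    exact isWeightedHomogeneous_X ℂ (wt n d) (Sum.inr l)
  · rw [conormalForm_im, toMap_eulerField, mem_quadric_iff.mp hp l, Matrix.mulVec_smul,
      dotProduct_smul, ← ofReal_hermForm (hA l)]
    simp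

lemma exists_mem_integrations_one_ne_zero {A : Fin 2 → Matrix (Fin n) (Fin n) ℂ}
    (hA : ∀ l, (A l).IsHermitian) : ∃ Y ∈ integrations A 1 (-1), Y ≠ 0 := by
  have hbracket : multiBracket ![1, 0] (eulerField n 2) (X (Sum.inr 0)) = -1 := by
    simp [multiBracket_two, bracketW, bracket_W_apply_X, eulerField]
  have hne : multiBracket ![1, 0] (eulerField n 2) ≠ 0 := fun h => by simp [h] at hbracket
  refine ⟨_, mem_integrations_neg_one hA (by simp) (by simpa using eulerField_mem_G hA) hne, ?_⟩
  intro h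
  exact hne (by rw [h, multiBracket_zero])

end EulerField

end QuadricAut

theorem mainTheorem5 (n : ℕ) (A : Fin 2 → Matrix (Fin n) (Fin n) ℂ)
    (hA : QuadricAut.Nondegenerate A) :
    (QuadricAut.integrations A 1 0 \
        (QuadricAut.integrations A 1 0 ∩ QuadricAut.integrations A 2 (-1)) ⊆ {0}) ∧
    QuadricAut.integrations A 2 (-1 / 2) = {0} ∧
    ((∃ Y ∈ QuadricAut.integrations A 1 (-1), Y ≠ 0) ∧
      QuadricAut.integrations A 3 (-1) = {0}) := by
  have hgen := hA.genericallyIndependent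
  refine ⟨?_, QuadricAut.integrations_two_neg_half hA.isHermitian hgen hA.ker_inter,
    QuadricAut.exists_mem_integrations_one_ne_zero hA.isHermitian,
    QuadricAut.integrations_three_neg_one hA.isHermitian hgen⟩
  rintro Y ⟨hY, hnot⟩
  by_contra hY0
  exact hnot ⟨hY, QuadricAut.integrations_one_zero_subset hA ⟨hY, hY0⟩⟩
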